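/- For $n\ge 1$ and a Hilbert space $H$, identify $M_n(B(H))$ with $B(\ell_2^n(H))$; this gives a norm on $M_n(X)$ for every closed subspace (operator space) $X\subseteq B(H)$. A linear map $u:X\to Y$ of operator spaces is completely bounded if $\sup_{n\ge1}\|u_n\|<\infty$, where $u_n:M_n(X)\to M_n(Y)$ applies $u$ entrywise, and $X$ and $Y$ are completely isomorphic if there is a linear bijection $u:X\to Y$ with $u$ and $u^{-1}$ completely bounded. For $X\subseteq B(H)$ and $Y\subseteq B(H')$, the direct sum $X\oplus Y\subseteq B(H\oplus_2 H')$ consists of the block diagonal operators $a\oplus b$, $a\in X$, $b\in Y$. Let $F_\infty$ be the free group on countably infinitely many generators, let $\lambda$ be its left regular representation on $\ell_2(F_\infty)$, and for $S\subseteq F_\infty$ let $C^*_\lambda(S)\subseteq B(\ell_2(F_\infty))$ be the norm closure of $\operatorname{span}\{\lambda(x):x\in S\}$; in particular $C^*_\lambda(F_\infty)$ is the reduced group $C^*$-algebra. Divide the generators of $F_\infty$ into two infinite sequences $\alpha_1,\alpha_2,\dots$ and $e_1,e_2,\dots$, let $F_\alpha$ be the subgroup generated by the $\alpha_i$, and let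 $K=\bigcup_{j\ge 1}e_jF_\alpha$ or $K=F_\alpha\cup\bigcup_{j\ge 1}e_jF_\alpha$ (that is, $K=\bigcup_{j\ge0}e_jF_\alpha$ with $e_0=1$). **Proposition 5.** In either case, $C^*_\lambda(K)$, $C^*_\lambda(F_\infty)$ and $C^*_\lambda(F_\infty)\oplus C^*_\lambda(F_\infty)$ are pairwise completely isomorphic. -/

import Mathlib

open scoped Pointwise

noncomputable section

/-! ### Operator spaces: subspaces of `B(H)` with their matrix norms -/

section OperatorSpaces

variable {H H' : Type*}
  [NormedAddCommGroup H] [InnerProductSpace ℂ H]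
  [NormedAddCommGroup H'] [InnerProductSpace ℂ H']

/-- The operator on `ℓ₂ⁿ(H) = H ⊕ ⋯ ⊕ H` given by an `n × n` matrix with entries in `B(H)`:
`(T q)ᵢ = ∑ⱼ Tᵢⱼ qⱼ`. -/
def matrixOp {n : ℕ} (T : Matrix (Fin n) (Fin n) (H →L[ℂ] H)) :
    PiLp 2 (fun _ : Fin n => H) →L[ℂ] PiLp 2 (fun _ : Fin n => H) :=
  ((PiLp.continuousLinearEquiv 2 ℂ (fun _ : Fin n => H)).symm :
      (Fin n → H) →L[ℂ] PiLp 2 (fun _ : Fin n => H)) ∘L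
    ContinuousLinearMap.pi (fun i => ∑ j, (T i j) ∘L PiLp.proj 2 (fun _ : Fin n => H) j)

theorem matrixOp_apply {n : ℕ} (T : Matrix (Fin n) (Fin n) (H →L[ℂ] H))
    (q : PiLp 2 (fun _ : Fin n => H)) (i : Fin n) :
    matrixOp T q i = ∑ j, T i j (q j) := by
  simp [matrixOp]

/-- The norm of `M_n(X)`, for a subspace `X` of `B(H)`, inherited from
`M_n(B(H)) = B(ℓ₂ⁿ(H))`. -/
def matrixNorm (X : Submodule ℂ (H →L[ℂ] H)) {n : ℕ} (x : Matrix (Fin n) (Fin n) X) : ℝ :=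
  ‖matrixOp (x.map (fun a : X => (a : H →L[ℂ] H)))‖

/-- A linear map `u : X → Y` is completely bounded if the maps `u_n : M_n(X) → M_n(Y)`, which
apply `u` entrywise, are bounded uniformly in `n`, i.e. `sup_n ‖u_n‖ < ∞`. -/
def IsCompletelyBounded {X : Submodule ℂ (H →L[ℂ] H)} {Y : Submodule ℂ (H' →L[ℂ] H')}
    (u : X →ₗ[ℂ] Y) : Prop :=
  ∃ C : ℝ, ∀ (n : ℕ) (x : Matrix (Fin n) (Fin n) X),
    matrixNorm Y (x.map u) ≤ C * matrixNorm X x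

/-- `X` and `Y` are completely isomorphic: there is a linear bijection `u : X → Y` such that
`u` and `u⁻¹` are completely bounded. -/
def CompletelyIsomorphic (X : Submodule ℂ (H →L[ℂ] H)) (Y : Submodule ℂ (H' →L[ℂ] H')) : Prop :=
  ∃ u : X ≃ₗ[ℂ] Y,
    IsCompletelyBounded (u : X →ₗ[ℂ] Y) ∧ IsCompletelyBounded (u.symm : Y →ₗ[ℂ] X)

/-- The block diagonal operator `a ⊕ b` on the Hilbert space direct sum `H ⊕₂ H'`, as a linear
function of the pair `(a, b)`. -/
def blockDiag : ((H →L[ℂ] H) × (H' →L[ℂ] H')) →ₗ[ℂ]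
    (WithLp 2 (H × H') →L[ℂ] WithLp 2 (H × H')) where
  toFun p := ((WithLp.prodContinuousLinearEquiv 2 ℂ H H').symm :
      H × H' →L[ℂ] WithLp 2 (H × H')) ∘L (p.1.prodMap p.2) ∘L
      (WithLp.prodContinuousLinearEquiv 2 ℂ H H' : WithLp 2 (H × H') →L[ℂ] H × H')
  map_add' p q := ContinuousLinearMap.ext fun _ => rfl
  map_smul' c p := ContinuousLinearMap.ext fun _ => rfl

theorem blockDiag_apply (a : H →L[ℂ] H) (b : H' →L[ℂ] H') (h : H) (k : H') :
    blockDiag (a, b) (WithLp.toLp 2 (h, k)) = WithLp.toLp 2 (a h, b k) := by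
  simp [blockDiag]

/-- The direct sum `X ⊕ Y` of `X ⊆ B(H)` and `Y ⊆ B(H')`, as the space of block diagonal
operators `a ⊕ b` (`a ∈ X`, `b ∈ Y`) in `B(H ⊕₂ H')`. -/
def opDirectSum (X : Submodule ℂ (H →L[ℂ] H)) (Y : Submodule ℂ (H' →L[ℂ] H')) :
    Submodule ℂ (WithLp 2 (H × H') →L[ℂ] WithLp 2 (H × H')) :=
  (X.prod Y).map blockDiag

end OperatorSpaces

/-! ### The left regular representation -/

section Regular

variable {G : Type*} [Group G]

/-- The Hilbert space `ℓ₂(G)`. -/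
abbrev EllTwo (G : Type*) : Type _ := lp (fun _ : G => ℂ) 2

/-- The left regular representation `λ : G → B(ℓ₂(G))`, `(λ(g) f)(x) = f(g⁻¹ x)`. -/
def leftReg (g : G) : EllTwo G →L[ℂ] EllTwo G :=
  LinearMap.mkContinuous
    { toFun := fun f => ⟨fun x => f (g⁻¹ * x), memℓp_gen <| by
        have h := (lp.memℓp f).summable (by norm_num)
        exact h.comp_injective (mul_right_injective g⁻¹)⟩
      map_add' := fun _ _ => rfl
      map_smul' := fun _ _ => rfl }
    1
    (fun f => by
      rw [one_mul, lp.norm_eq_tsum_rpow (by norm_num), lp.norm_eq_tsum_rpow (by norm_num)]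
      exact le_of_eq (congrArg (fun t : ℝ => t ^ (1 / (2 : ENNReal).toReal))
        ((Equiv.mulLeft g⁻¹).tsum_eq (fun x => ‖f x‖ ^ (2 : ENNReal).toReal))))

theorem leftReg_apply (g : G) (f : EllTwo G) (x : G) : leftReg g f x = f (g⁻¹ * x) := rfl

/-- `λ(g)` maps the basis vector `e_x` to `e_{gx}`. -/
theorem leftReg_single [DecidableEq G] (g x : G) :
    leftReg g (lp.single 2 x (1 : ℂ)) = lp.single 2 (g * x) (1 : ℂ) := by
  ext y
  rw [leftReg_apply]
  by_cases h : y = g * x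
  · subst h
    simp
  · have h' : g⁻¹ * y ≠ x := fun h'' => h (by rw [← h'', mul_inv_cancel_left])
    simp [lp.single_apply, h, h']

/-- For `S ⊆ G`, the norm closure `C*_λ(S)` in `B(ℓ₂(G))` of the linear span of
`{λ(x) : x ∈ S}`. -/
def cLambdaSet (S : Set G) : Submodule ℂ (EllTwo G →L[ℂ] EllTwo G) :=
  (Submodule.span ℂ (leftReg '' S)).topologicalClosure

/-- The reduced group C*-algebra `C*_λ(G) ⊆ B(ℓ₂(G))`: the norm closure of the linear span of
the operators `λ(x)`, `x ∈ G`. -/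
def cLambda (G : Type*) [Group G] : Submodule ℂ (EllTwo G →L[ℂ] EllTwo G) :=
  cLambdaSet (Set.univ : Set G)

end Regular

/-! ### The subset `K` of the free group

A division of the generators of `F_∞ = FreeGroup ℕ` into two sequences `α` and `e` is a bijection
`d : ℕ ⊕ ℕ ≃ ℕ`. -/

/-- The subgroup `F_α` generated by the `α`'s. -/
def subgroupAlpha (d : ℕ ⊕ ℕ ≃ ℕ) : Subgroup (FreeGroup ℕ) :=
  Subgroup.closure (Set.range fun i : ℕ => FreeGroup.of (d (Sum.inl i)))

/-- The union of the cosets `e_j F_α` over all the generators `e_j`. -/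
def setK (d : ℕ ⊕ ℕ ≃ ℕ) : Set (FreeGroup ℕ) :=
  ⋃ j : ℕ, FreeGroup.of (d (Sum.inr j)) • (subgroupAlpha d : Set (FreeGroup ℕ))

end

/-! Write F for the free group and K for the union of the cosets `e_j F_α`. The argument is a
decomposition scheme that rests on one analytic fact: for every set `J` of indices, the projection
of `C*_λ(F)` onto the span of the `e_j F_α`, `j ∈ J`, is completely bounded
(`isMultiplierSet_cosetUnion`). The indicator kernel at `x y⁻¹` is a sum of two block diagonal
kernels, according to whether the reduced word of `x` begins with `e_j` or not, and a block diagonal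
kernel gives a complete contraction.

Hence disjoint unions of index sets become direct sums. Injective homomorphisms and left
translations preserve the isomorphism class (`extendablyIsomorphic_image`,
`extendablyIsomorphic_smul`), so every infinite `J` gives a copy of `C*_λ(K)`. The even and odd
indices give K ≃ K ⊕ K, with each set standing for its space. A free change of generators followed
by a translation turns `F_α ∪ ⋃_{j ≥ 1} e_j F_α` into K (indices start at 0), so K ≃ K ⊕ F, as `F_α`
is a copy of F. Removing the even half of K from F leaves a copy of F, so F ≃ K ⊕ F. Therefore K ≃
F, and K ≃ K ⊕ K gives F ≃ F ⊕ F. -/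

noncomputable section

/-! ### Completely bounded maps on `B(H)` and isomorphisms induced by them -/

section CompletelyBoundedMaps

variable {H H' H'' : Type*}
  [NormedAddCommGroup H] [InnerProductSpace ℂ H]
  [NormedAddCommGroup H'] [InnerProductSpace ℂ H']
  [NormedAddCommGroup H''] [InnerProductSpace ℂ H'']

theorem norm_matrixOp_apply_sq {n : ℕ} (T : Matrix (Fin n) (Fin n) (H →L[ℂ] H))
    (q : PiLp 2 (fun _ : Fin n => H)) :
    ‖matrixOp T q‖ ^ 2 = ∑ i, ‖∑ j, T i j (q j)‖ ^ 2 := by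
  rw [PiLp.norm_sq_eq_of_L2]
  simp only [matrixOp_apply]

theorem norm_matrixOp_le_iff {n : ℕ} (T : Matrix (Fin n) (Fin n) (H →L[ℂ] H)) {C : ℝ}
    (hC : 0 ≤ C) :
    ‖matrixOp T‖ ≤ C ↔
      ∀ q : Fin n → H, ∑ i, ‖∑ j, T i j (q j)‖ ^ 2 ≤ C ^ 2 * ∑ j, ‖q j‖ ^ 2 := by
  constructor
  · intro h q
    have h1 := (matrixOp T).le_of_opNorm_le h (WithLp.toLp 2 q)
    have h2 := pow_le_pow_left₀ (norm_nonneg _) h1 2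
    rwa [norm_matrixOp_apply_sq, mul_pow, PiLp.norm_sq_eq_of_L2] at h2
  · intro h
    refine ContinuousLinearMap.opNorm_le_bound _ hC fun q => ?_
    refine le_of_sq_le_sq ?_ (by positivity)
    rw [norm_matrixOp_apply_sq, mul_pow, PiLp.norm_sq_eq_of_L2]
    exact h q

/-- A linear map `B(H) → B(H')` all of whose amplifications are uniformly bounded. -/
def IsCBMap (Φ : (H →L[ℂ] H) →ₗ[ℂ] (H' →L[ℂ] H')) : Prop :=
  ∃ C : ℝ, 0 ≤ C ∧ ∀ (n : ℕ) (T : Matrix (Fin n) (Fin n) (H →L[ℂ] H)),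
    ‖matrixOp (T.map Φ)‖ ≤ C * ‖matrixOp T‖

theorem matrixOp_add {n : ℕ} (S T : Matrix (Fin n) (Fin n) (H →L[ℂ] H)) :
    matrixOp (S + T) = matrixOp S + matrixOp T := by
  ext q i
  simp [matrixOp_apply, Finset.sum_add_distrib]

theorem matrixOp_sub {n : ℕ} (S T : Matrix (Fin n) (Fin n) (H →L[ℂ] H)) :
    matrixOp (S - T) = matrixOp S - matrixOp T := by
  ext q i
  simp [matrixOp_apply, Finset.sum_sub_distrib]

theorem norm_matrixOp_fin_one (T : H →L[ℂ] H) :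
    ‖matrixOp (fun _ _ : Fin 1 => T)‖ = ‖T‖ := by
  refine le_antisymm ((norm_matrixOp_le_iff _ (norm_nonneg _)).2 fun q => ?_)
    (T.opNorm_le_bound (norm_nonneg (matrixOp fun _ _ : Fin 1 => T)) fun x => ?_)
  · simpa [← mul_pow] using pow_le_pow_left₀ (norm_nonneg _) (T.le_opNorm (q 0)) 2
  · have h := (norm_matrixOp_le_iff (fun _ _ : Fin 1 => T) (norm_nonneg (matrixOp fun _ _ : Fin 1 => T))).1 le_rfl
      (fun _ => x)
    refine le_of_sq_le_sq ?_ (by positivity)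
    simpa [mul_pow] using h

namespace IsCBMap

theorem continuous {Φ : (H →L[ℂ] H) →ₗ[ℂ] (H' →L[ℂ] H')} (h : IsCBMap Φ) : Continuous Φ := by
  obtain ⟨C, -, h⟩ := h
  refine AddMonoidHomClass.continuous_of_bound Φ C fun T => ?_
  have := h 1 (fun _ _ => T)
  rw [norm_matrixOp_fin_one] at this
  exact (norm_matrixOp_fin_one (Φ T)).symm.trans_le this

theorem add {Φ Ψ : (H →L[ℂ] H) →ₗ[ℂ] (H' →L[ℂ] H')} (hΦ : IsCBMap Φ) (hΨ : IsCBMap Ψ) :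
    IsCBMap (Φ + Ψ) := by
  obtain ⟨C, hC, h⟩ := hΦ
  obtain ⟨D, hD, k⟩ := hΨ
  refine ⟨C + D, add_nonneg hC hD, fun n T => ?_⟩
  have : T.map (Φ + Ψ) = T.map Φ + T.map Ψ := rfl
  rw [this, matrixOp_add, add_mul]
  exact (norm_add_le (matrixOp (T.map Φ)) (matrixOp (T.map Ψ))).trans (add_le_add (h n T) (k n T))

theorem comp {Φ : (H →L[ℂ] H) →ₗ[ℂ] (H' →L[ℂ] H')} {Ψ : (H' →L[ℂ] H') →ₗ[ℂ] (H'' →L[ℂ] H'')}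
    (hΨ : IsCBMap Ψ) (hΦ : IsCBMap Φ) : IsCBMap (Ψ ∘ₗ Φ) := by
  obtain ⟨C, hC, h⟩ := hΦ
  obtain ⟨D, hD, k⟩ := hΨ
  refine ⟨D * C, mul_nonneg hD hC, fun n T => ?_⟩
  rw [mul_assoc]
  exact (k n (T.map Φ)).trans (mul_le_mul_of_nonneg_left (h n T) hD)

theorem id : IsCBMap (LinearMap.id : (H →L[ℂ] H) →ₗ[ℂ] (H →L[ℂ] H)) :=
  ⟨1, zero_le_one, fun n T => by simp⟩

theorem sub {Φ Ψ : (H →L[ℂ] H) →ₗ[ℂ] (H' →L[ℂ] H')} (hΦ : IsCBMap Φ) (hΨ : IsCBMap Ψ) :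
    IsCBMap (Φ - Ψ) := by
  obtain ⟨C, hC, h⟩ := hΦ
  obtain ⟨D, hD, k⟩ := hΨ
  refine ⟨C + D, add_nonneg hC hD, fun n T => ?_⟩
  have : T.map (Φ - Ψ) = T.map Φ - T.map Ψ := rfl
  rw [this, matrixOp_sub, add_mul]
  exact (norm_sub_le (matrixOp (T.map Φ)) (matrixOp (T.map Ψ))).trans (add_le_add (h n T) (k n T))

theorem isCompletelyBounded {Φ : (H →L[ℂ] H) →ₗ[ℂ] (H' →L[ℂ] H')} (hΦ : IsCBMap Φ)
    {X : Submodule ℂ (H →L[ℂ] H)} {Y : Submodule ℂ (H' →L[ℂ] H')} {u : X →ₗ[ℂ] Y}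
    (hu : ∀ x : X, (u x : H' →L[ℂ] H') = Φ x) : IsCompletelyBounded u := by
  obtain ⟨C, -, h⟩ := hΦ
  refine ⟨C, fun n x => ?_⟩
  have e : (x.map u).map (fun a : Y => (a : H' →L[ℂ] H')) =
      (x.map (fun a : X => (a : H →L[ℂ] H))).map Φ := by
    ext1 i j
    exact hu _
  rw [matrixNorm, e]
  exact h n _

end IsCBMap

/-- The map `T ↦ A T B`. -/
def sandwich (A : H →L[ℂ] H') (B : H' →L[ℂ] H) : (H →L[ℂ] H) →ₗ[ℂ] (H' →L[ℂ] H') where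
  toFun T := A ∘L T ∘L B
  map_add' S T := by ext; simp
  map_smul' c T := by ext; simp

@[simp]
theorem sandwich_apply (A : H →L[ℂ] H') (B : H' →L[ℂ] H) (T : H →L[ℂ] H) (x : H') :
    sandwich A B T x = A (T (B x)) := rfl

/-- Amplifying `T ↦ A T B` multiplies by the diagonal matrices of `A` and `B`, whose norms do not
grow with `n`. -/
theorem isCBMap_sandwich (A : H →L[ℂ] H') (B : H' →L[ℂ] H) : IsCBMap (sandwich A B) := by
  refine ⟨‖A‖ * ‖B‖, by positivity, fun n T => (norm_matrixOp_le_iff _ (by positivity)).2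
    fun q => ?_⟩
  have h := (norm_matrixOp_le_iff T (norm_nonneg (matrixOp T))).1 le_rfl (fun j => B (q j))
  calc ∑ i, ‖∑ j, (T.map (sandwich A B)) i j (q j)‖ ^ 2
      = ∑ i, ‖A (∑ j, T i j (B (q j)))‖ ^ 2 := by simp
    _ ≤ ∑ i, ‖A‖ ^ 2 * ‖∑ j, T i j (B (q j))‖ ^ 2 := by
        gcongr with i
        rw [← mul_pow]
        gcongr
        exact A.le_opNorm _
    _ ≤ ‖A‖ ^ 2 * (‖matrixOp T‖ ^ 2 * ∑ j, ‖B (q j)‖ ^ 2) := by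
        rw [← Finset.mul_sum]
        gcongr
    _ ≤ ‖A‖ ^ 2 * (‖matrixOp T‖ ^ 2 * ∑ j, (‖B‖ * ‖q j‖) ^ 2) := by
        gcongr with j
        exact B.le_opNorm _
    _ = _ := by
        simp only [mul_pow, ← Finset.mul_sum]
        ring

/-- Complete isomorphism through completely bounded maps that are defined on all of `B(H)`. -/
def ExtendablyIsomorphic (X : Submodule ℂ (H →L[ℂ] H)) (Y : Submodule ℂ (H' →L[ℂ] H')) : Prop :=
  ∃ (Φ : (H →L[ℂ] H) →ₗ[ℂ] (H' →L[ℂ] H')) (Ψ : (H' →L[ℂ] H') →ₗ[ℂ] (H →L[ℂ] H)),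
    IsCBMap Φ ∧ IsCBMap Ψ ∧ (∀ x ∈ X, Φ x ∈ Y ∧ Ψ (Φ x) = x) ∧ (∀ y ∈ Y, Ψ y ∈ X ∧ Φ (Ψ y) = y)

namespace ExtendablyIsomorphic

variable {X : Submodule ℂ (H →L[ℂ] H)} {Y : Submodule ℂ (H' →L[ℂ] H')}
  {Z : Submodule ℂ (H'' →L[ℂ] H'')}

theorem completelyIsomorphic (h : ExtendablyIsomorphic X Y) : CompletelyIsomorphic X Y := by
  obtain ⟨Φ, Ψ, hΦ, hΨ, hX, hY⟩ := h
  refine ⟨LinearEquiv.ofLinearMap (Φ.restrict fun x hx => (hX x hx).1)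
    (Ψ.restrict fun y hy => (hY y hy).1) ?_ ?_, ?_, ?_⟩
  · ext1 y
    exact Subtype.ext (hY y y.2).2
  · ext1 x
    exact Subtype.ext (hX x x.2).2
  · exact hΦ.isCompletelyBounded fun x => rfl
  · exact hΨ.isCompletelyBounded fun x => rfl

theorem refl (X : Submodule ℂ (H →L[ℂ] H)) : ExtendablyIsomorphic X X :=
  ⟨LinearMap.id, LinearMap.id, IsCBMap.id, IsCBMap.id, fun _ h => ⟨h, rfl⟩, fun _ h => ⟨h, rfl⟩⟩

theorem symm (h : ExtendablyIsomorphic X Y) : ExtendablyIsomorphic Y X := by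
  obtain ⟨Φ, Ψ, hΦ, hΨ, hX, hY⟩ := h
  exact ⟨Ψ, Φ, hΨ, hΦ, hY, hX⟩

theorem trans (h : ExtendablyIsomorphic X Y) (k : ExtendablyIsomorphic Y Z) :
    ExtendablyIsomorphic X Z := by
  obtain ⟨Φ, Ψ, hΦ, hΨ, hX, hY⟩ := h
  obtain ⟨Φ', Ψ', hΦ', hΨ', hY', hZ'⟩ := k
  refine ⟨Φ' ∘ₗ Φ, Ψ ∘ₗ Ψ', hΦ'.comp hΦ, hΨ.comp hΨ', fun x hx => ⟨?_, ?_⟩, fun z hz => ⟨?_, ?_⟩⟩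
  · exact (hY' _ (hX x hx).1).1
  · simp [(hY' _ (hX x hx).1).2, (hX x hx).2]
  · exact (hY _ (hZ' z hz).1).1
  · simp [(hY _ (hZ' z hz).1).2, (hZ' z hz).2]

end ExtendablyIsomorphic

/-! ### Direct sums and complementary projections -/

section DirectSum

variable (H H')

/-- The inclusion of the first summand of `H ⊕₂ H'`. -/
def inlL2 : H →L[ℂ] WithLp 2 (H × H') :=
  ((WithLp.prodContinuousLinearEquiv 2 ℂ H H').symm : H × H' →L[ℂ] WithLp 2 (H × H')) ∘L
    ContinuousLinearMap.inl ℂ H H'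

/-- The inclusion of the second summand of `H ⊕₂ H'`. -/
def inrL2 : H' →L[ℂ] WithLp 2 (H × H') :=
  ((WithLp.prodContinuousLinearEquiv 2 ℂ H H').symm : H × H' →L[ℂ] WithLp 2 (H × H')) ∘L
    ContinuousLinearMap.inr ℂ H H'

/-- The projection to the first summand of `H ⊕₂ H'`. -/
def fstL2 : WithLp 2 (H × H') →L[ℂ] H :=
  ContinuousLinearMap.fst ℂ H H' ∘L
    (WithLp.prodContinuousLinearEquiv 2 ℂ H H' : WithLp 2 (H × H') →L[ℂ] H × H')

/-- The projection to the second summand of `H ⊕₂ H'`. -/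
def sndL2 : WithLp 2 (H × H') →L[ℂ] H' :=
  ContinuousLinearMap.snd ℂ H H' ∘L
    (WithLp.prodContinuousLinearEquiv 2 ℂ H H' : WithLp 2 (H × H') →L[ℂ] H × H')

variable {H H'}

theorem sandwich_inlL2 (a : H →L[ℂ] H) :
    sandwich (inlL2 H H') (fstL2 H H') a = blockDiag (a, (0 : H' →L[ℂ] H')) := by
  refine ContinuousLinearMap.ext fun x => WithLp.ofLp_injective 2 ?_
  exact Prod.ext rfl rfl

theorem sandwich_inrL2 (b : H' →L[ℂ] H') :
    sandwich (inrL2 H H') (sndL2 H H') b = blockDiag ((0 : H →L[ℂ] H), b) := by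
  refine ContinuousLinearMap.ext fun x => WithLp.ofLp_injective 2 ?_
  exact Prod.ext rfl rfl

theorem sandwich_fstL2 (a : H →L[ℂ] H) (b : H' →L[ℂ] H') :
    sandwich (fstL2 H H') (inlL2 H H') (blockDiag (a, b)) = a := by
  ext x
  simp [inlL2, fstL2, blockDiag]

theorem sandwich_sndL2 (a : H →L[ℂ] H) (b : H' →L[ℂ] H') :
    sandwich (sndL2 H H') (inrL2 H H') (blockDiag (a, b)) = b := by
  ext x
  simp [inrL2, sndL2, blockDiag]

theorem blockDiag_eq_add (a : H →L[ℂ] H) (b : H' →L[ℂ] H') :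
    blockDiag (a, b) = sandwich (inlL2 H H') (fstL2 H H') a +
      sandwich (inrL2 H H') (sndL2 H H') b := by
  rw [sandwich_inlL2, sandwich_inrL2, ← map_add]
  simp

theorem blockDiag_mem_opDirectSum {X : Submodule ℂ (H →L[ℂ] H)} {Y : Submodule ℂ (H' →L[ℂ] H')}
    {a : H →L[ℂ] H} {b : H' →L[ℂ] H'} (ha : a ∈ X) (hb : b ∈ Y) :
    blockDiag (a, b) ∈ opDirectSum X Y :=
  ⟨(a, b), ⟨ha, hb⟩, rfl⟩

/-- A space that is the sum of the ranges of two complementary completely bounded projections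
is isomorphic to the direct sum of the ranges. -/
theorem extendablyIsomorphic_opDirectSum {K : Type*} [NormedAddCommGroup K]
    [InnerProductSpace ℂ K] {Z : Submodule ℂ (K →L[ℂ] K)}
    {X : Submodule ℂ (H →L[ℂ] H)} {Y : Submodule ℂ (H' →L[ℂ] H')}
    {P : (K →L[ℂ] K) →ₗ[ℂ] (H →L[ℂ] H)} {Q : (K →L[ℂ] K) →ₗ[ℂ] (H' →L[ℂ] H')}
    {I : (H →L[ℂ] H) →ₗ[ℂ] (K →L[ℂ] K)} {J : (H' →L[ℂ] H') →ₗ[ℂ] (K →L[ℂ] K)}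
    (hP : IsCBMap P) (hQ : IsCBMap Q) (hI : IsCBMap I) (hJ : IsCBMap J)
    (hZ : ∀ z ∈ Z, P z ∈ X ∧ Q z ∈ Y ∧ I (P z) + J (Q z) = z)
    (hX : ∀ x ∈ X, I x ∈ Z ∧ P (I x) = x ∧ Q (I x) = 0)
    (hY : ∀ y ∈ Y, J y ∈ Z ∧ P (J y) = 0 ∧ Q (J y) = y) :
    ExtendablyIsomorphic Z (opDirectSum X Y) := by
  refine ⟨sandwich (inlL2 H H') (fstL2 H H') ∘ₗ P + sandwich (inrL2 H H') (sndL2 H H') ∘ₗ Q,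
    I ∘ₗ sandwich (fstL2 H H') (inlL2 H H') + J ∘ₗ sandwich (sndL2 H H') (inrL2 H H'),
    ((isCBMap_sandwich _ _).comp hP).add ((isCBMap_sandwich _ _).comp hQ),
    (hI.comp (isCBMap_sandwich _ _)).add (hJ.comp (isCBMap_sandwich _ _)), fun z hz => ?_, ?_⟩
  · obtain ⟨h1, h2, h3⟩ := hZ z hz
    simp only [LinearMap.add_apply, LinearMap.comp_apply, ← blockDiag_eq_add, sandwich_fstL2,
      sandwich_sndL2]
    exact ⟨blockDiag_mem_opDirectSum h1 h2, h3⟩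
  · rintro _ ⟨⟨a, b⟩, ⟨ha, hb⟩, rfl⟩
    obtain ⟨h1, h2, h3⟩ := hX a ha
    obtain ⟨k1, k2, k3⟩ := hY b hb
    simp only [LinearMap.add_apply, LinearMap.comp_apply, sandwich_fstL2, sandwich_sndL2, map_add,
      h2, h3, k2, k3, map_zero, add_zero, zero_add]
    exact ⟨add_mem h1 k1, (blockDiag_eq_add a b).symm⟩

theorem ExtendablyIsomorphic.opDirectSum {H₁ H₂ : Type*}
    [NormedAddCommGroup H₁] [InnerProductSpace ℂ H₁]
    [NormedAddCommGroup H₂] [InnerProductSpace ℂ H₂]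
    {X : Submodule ℂ (H →L[ℂ] H)} {Y : Submodule ℂ (H' →L[ℂ] H')}
    {X₁ : Submodule ℂ (H₁ →L[ℂ] H₁)} {Y₁ : Submodule ℂ (H₂ →L[ℂ] H₂)}
    (h : ExtendablyIsomorphic X X₁) (k : ExtendablyIsomorphic Y Y₁) :
    ExtendablyIsomorphic (opDirectSum X Y) (opDirectSum X₁ Y₁) := by
  obtain ⟨Φ, Ψ, hΦ, hΨ, hX, hX₁⟩ := h
  obtain ⟨Φ', Ψ', hΦ', hΨ', hY, hY₁⟩ := k
  refine extendablyIsomorphic_opDirectSum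
    (hΦ.comp (isCBMap_sandwich (fstL2 H H') (inlL2 H H')))
    (hΦ'.comp (isCBMap_sandwich (sndL2 H H') (inrL2 H H')))
    ((isCBMap_sandwich (inlL2 H H') (fstL2 H H')).comp hΨ)
    ((isCBMap_sandwich (inrL2 H H') (sndL2 H H')).comp hΨ') ?_ (fun x hx => ?_) (fun y hy => ?_)
  · rintro _ ⟨⟨a, b⟩, ⟨ha, hb⟩, rfl⟩
    simp only [LinearMap.comp_apply, sandwich_fstL2, sandwich_sndL2, ← blockDiag_eq_add]
    exact ⟨(hX a ha).1, (hY b hb).1, by rw [(hX a ha).2, (hY b hb).2]⟩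
  · simp only [LinearMap.comp_apply, sandwich_inlL2, sandwich_fstL2, sandwich_sndL2, map_zero]
    exact ⟨blockDiag_mem_opDirectSum (hX₁ x hx).1 (zero_mem _), (hX₁ x hx).2, trivial⟩
  · simp only [LinearMap.comp_apply, sandwich_inrL2, sandwich_fstL2, sandwich_sndL2, map_zero]
    exact ⟨blockDiag_mem_opDirectSum (zero_mem _) (hY₁ y hy).1, trivial, (hY₁ y hy).2⟩

end DirectSum

end CompletelyBoundedMaps

/-! ### Operators on `ℓ₂` spaces: restriction, extension by zero, ampliation -/

section EllTwoMaps

variable {I X Y Z : Type*}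

theorem EllTwo.hasSum_norm_sq (ξ : EllTwo X) : HasSum (fun x => ‖ξ x‖ ^ 2) (‖ξ‖ ^ 2) := by
  simpa using lp.hasSum_norm (p := 2) (by norm_num) ξ

theorem memℓp_two_iff {f : X → ℂ} : Memℓp f 2 ↔ Summable fun x => ‖f x‖ ^ 2 := by
  simpa using memℓp_gen_iff (p := 2) (f := f) (by norm_num)

theorem hasSum_norm_sq_extend {p : Y → Z} (hp : p.Injective) (ξ : EllTwo Y) :
    HasSum (fun z => ‖Function.extend p ξ 0 z‖ ^ 2) (‖ξ‖ ^ 2) := by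
  refine (hp.hasSum_iff fun z hz => ?_).1 ?_
  · simp [Function.extend_apply' _ _ _ hz]
  · simpa [Function.comp_def, hp.extend_apply] using ξ.hasSum_norm_sq

/-- The vector in `ℓ₂(X)` with given coordinates. -/
def EllTwo.ofSummable (f : X → ℂ) (h : Summable fun x => ‖f x‖ ^ 2) : EllTwo X :=
  ⟨f, memℓp_two_iff.2 h⟩

theorem EllTwo.norm_ofSummable_le {f : X → ℂ} {s C : ℝ} (hC : 0 ≤ C) (hs : s ≤ C ^ 2)
    (h : HasSum (fun x => ‖f x‖ ^ 2) s) : ‖EllTwo.ofSummable f h.summable‖ ≤ C :=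
  le_of_sq_le_sq
    (((EllTwo.ofSummable f h.summable).hasSum_norm_sq.unique h).trans_le hs) hC

/-- The bounded operator `ℓ₂(X) → ℓ₂(Y)` given by a linear map `φ : ℓ₂(X) → ℂ^Y` that satisfies
an `ℓ₂`-bound. -/
def EllTwo.mkOp (φ : EllTwo X →ₗ[ℂ] (Y → ℂ)) (C : ℝ) (hC : 0 ≤ C)
    (h : ∀ ξ, ∃ s ≤ (C * ‖ξ‖) ^ 2, HasSum (fun y => ‖φ ξ y‖ ^ 2) s) :
    EllTwo X →L[ℂ] EllTwo Y :=
  LinearMap.mkContinuous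
    { toFun := fun ξ => EllTwo.ofSummable (φ ξ) (h ξ).choose_spec.2.summable
      map_add' := fun ξ η => Subtype.ext (map_add φ ξ η)
      map_smul' := fun c ξ => Subtype.ext (map_smul φ c ξ) }
    C
    (fun ξ => EllTwo.norm_ofSummable_le (mul_nonneg hC (norm_nonneg ξ)) (h ξ).choose_spec.1
      (h ξ).choose_spec.2)

/-- Composition with an injection `p : Y → Z`, as an operator `ℓ₂(Z) → ℓ₂(Y)`. -/
def pullback (p : Y → Z) (hp : p.Injective) : EllTwo Z →L[ℂ] EllTwo Y :=
  EllTwo.mkOp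
    { toFun := fun ξ y => ξ (p y)
      map_add' := fun _ _ => rfl
      map_smul' := fun _ _ => rfl }
    1 zero_le_one
    (fun ξ => by
      have h := (ξ.hasSum_norm_sq.summable.comp_injective hp).hasSum
      refine ⟨_, ?_, h⟩
      rw [one_mul]
      exact hasSum_le_inj p hp (fun _ _ => by positivity) (fun _ => le_rfl) h ξ.hasSum_norm_sq)

@[simp]
theorem pullback_apply (p : Y → Z) (hp : p.Injective) (ξ : EllTwo Z) (y : Y) :
    pullback p hp ξ y = ξ (p y) := rfl

/-- Extension by zero along an injection `p : Y → Z`, as an operator `ℓ₂(Y) → ℓ₂(Z)`. -/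
def pushforward (p : Y → Z) (hp : p.Injective) : EllTwo Y →L[ℂ] EllTwo Z :=
  EllTwo.mkOp
    { toFun := fun ξ => Function.extend p ξ 0
      map_add' := fun ξ η => by
        have h := Function.extend_add p ξ η (0 : Z → ℂ) 0
        rw [add_zero] at h
        exact h
      map_smul' := fun c ξ => by simpa using Function.extend_smul c p ξ (0 : Z → ℂ) }
    1 zero_le_one
    (fun ξ => ⟨_, by rw [one_mul], hasSum_norm_sq_extend hp ξ⟩)

@[simp]
theorem pushforward_apply_self (p : Y → Z) (hp : p.Injective) (ξ : EllTwo Y) (y : Y) :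
    pushforward p hp ξ (p y) = ξ y := hp.extend_apply _ _ _

theorem pushforward_apply_of_notMem (p : Y → Z) (hp : p.Injective) (ξ : EllTwo Y) {z : Z}
    (hz : ¬∃ y, p y = z) : pushforward p hp ξ z = 0 := Function.extend_apply' _ _ _ hz

/-- The restriction of `ξ ∈ ℓ₂(I × X)` to `{i} × X`. -/
def slice (i : I) : EllTwo (I × X) →L[ℂ] EllTwo X :=
  pullback (Prod.mk i) (Prod.mk_right_injective i)

@[simp]
theorem slice_apply (i : I) (ξ : EllTwo (I × X)) (x : X) : slice i ξ x = ξ (i, x) := rfl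

theorem hasSum_norm_sq_slice (ξ : EllTwo (I × X)) :
    HasSum (fun i => ‖slice i ξ‖ ^ 2) (‖ξ‖ ^ 2) :=
  ξ.hasSum_norm_sq.prod_fiberwise fun i => (slice i ξ).hasSum_norm_sq

theorem exists_hasSum_norm_sq_ampliation (T : EllTwo X →L[ℂ] EllTwo X) (ξ : EllTwo (I × X)) :
    ∃ s ≤ (‖T‖ * ‖ξ‖) ^ 2, HasSum (fun z : I × X => ‖T (slice z.1 ξ) z.2‖ ^ 2) s := by
  have hle : ∀ i, ‖T (slice i ξ)‖ ^ 2 ≤ ‖T‖ ^ 2 * ‖slice i ξ‖ ^ 2 := fun i => by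
    rw [← mul_pow]
    exact pow_le_pow_left₀ (norm_nonneg _) (T.le_opNorm _) 2
  have hsum : Summable fun i => ‖T (slice i ξ)‖ ^ 2 :=
    Summable.of_nonneg_of_le (fun i => by positivity) hle
      ((hasSum_norm_sq_slice ξ).summable.mul_left (‖T‖ ^ 2))
  have h : Summable fun z : I × X => ‖T (slice z.1 ξ) z.2‖ ^ 2 := by
    refine (summable_prod_of_nonneg fun _ => by positivity).2
      ⟨fun i => (T (slice i ξ)).hasSum_norm_sq.summable, ?_⟩
    simpa only [fun i => (T (slice i ξ)).hasSum_norm_sq.tsum_eq] using hsum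
  refine ⟨_, ?_, h.hasSum⟩
  rw [mul_pow]
  exact hasSum_le hle (h.hasSum.prod_fiberwise fun i => (T (slice i ξ)).hasSum_norm_sq)
    ((hasSum_norm_sq_slice ξ).mul_left (‖T‖ ^ 2))

/-- The operator `1 ⊗ T` on `ℓ₂(I × X)`, for an operator `T` on `ℓ₂(X)`. -/
def ampliation (I : Type*) {X : Type*} :
    (EllTwo X →L[ℂ] EllTwo X) →ₗ[ℂ] (EllTwo (I × X) →L[ℂ] EllTwo (I × X)) where
  toFun T := EllTwo.mkOp
    { toFun := fun ξ z => T (slice z.1 ξ) z.2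
      map_add' := fun ξ η => by
        ext z
        simp only [map_add, lp.coeFn_add, Pi.add_apply]
      map_smul' := fun c ξ => by
        ext z
        simp only [map_smul, lp.coeFn_smul, Pi.smul_apply, RingHom.id_apply] }
    ‖T‖ (norm_nonneg T) (exists_hasSum_norm_sq_ampliation T)
  map_add' S T := by
    ext ξ z
    rfl
  map_smul' c T := by
    ext ξ z
    rfl

@[simp]
theorem ampliation_apply (T : EllTwo X →L[ℂ] EllTwo X) (ξ : EllTwo (I × X)) (z : I × X) :
    ampliation I T ξ z = T (slice z.1 ξ) z.2 := rfl

theorem slice_ampliation (T : EllTwo X →L[ℂ] EllTwo X) (ξ : EllTwo (I × X)) (i : I) :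
    slice i (ampliation I T ξ) = T (slice i ξ) := rfl

/-- A matrix of operators `1 ⊗ T` acts on each slice `{i} × X` separately, so the bound for the
matrix of the `T`'s can be summed over `i`. -/
theorem isCBMap_ampliation : IsCBMap (ampliation I (X := X)) := by
  refine ⟨1, zero_le_one, fun n T => ?_⟩
  rw [one_mul]
  refine (norm_matrixOp_le_iff _ (norm_nonneg (matrixOp T))).2 fun q => ?_
  refine hasSum_le (fun i => ?_)
    (hasSum_sum fun k _ => hasSum_norm_sq_slice (∑ j, T.map (ampliation I) k j (q j)))
    ((hasSum_sum fun j _ => hasSum_norm_sq_slice (q j)).mul_left (‖matrixOp T‖ ^ 2))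
  simpa [slice_ampliation] using
    (norm_matrixOp_le_iff T (norm_nonneg (matrixOp T))).1 le_rfl (fun j => slice i (q j))

end EllTwoMaps

/-! ### Maps between the spaces `C*_λ(S)`, and multiplier sets -/

section Regular

variable {G G' : Type*} [Group G] [Group G']

theorem leftReg_mem_cLambdaSet {S : Set G} {g : G} (hg : g ∈ S) : leftReg g ∈ cLambdaSet S :=
  Submodule.le_topologicalClosure _ (Submodule.subset_span ⟨g, hg, rfl⟩)

theorem leftReg_mul (g h : G) : leftReg (g * h) = leftReg g ∘L leftReg h := by
  ext ξ x
  simp [leftReg_apply, mul_assoc]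

theorem IsCBMap.map_cLambdaSet_mem {H : Type*} [NormedAddCommGroup H] [InnerProductSpace ℂ H]
    {Φ : (EllTwo G →L[ℂ] EllTwo G) →ₗ[ℂ] (H →L[ℂ] H)} (hΦ : IsCBMap Φ) {S : Set G}
    {V : Submodule ℂ (H →L[ℂ] H)} (hV : IsClosed (V : Set (H →L[ℂ] H)))
    (h : ∀ g ∈ S, Φ (leftReg g) ∈ V) {T : EllTwo G →L[ℂ] EllTwo G} (hT : T ∈ cLambdaSet S) :
    Φ T ∈ V := by
  have hle : cLambdaSet S ≤ V.comap Φ := by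
    refine Submodule.topologicalClosure_minimal _ (Submodule.span_le.2 ?_)
      (hV.preimage hΦ.continuous)
    rintro _ ⟨g, hg, rfl⟩
    exact h g hg
  exact hle hT

theorem isClosed_cLambdaSet (S : Set G) :
    IsClosed (cLambdaSet S : Set (EllTwo G →L[ℂ] EllTwo G)) :=
  Submodule.isClosed_topologicalClosure _

theorem IsCBMap.eqOn_cLambdaSet {H : Type*} [NormedAddCommGroup H] [InnerProductSpace ℂ H]
    {Φ Ψ : (EllTwo G →L[ℂ] EllTwo G) →ₗ[ℂ] (H →L[ℂ] H)} (hΦ : IsCBMap Φ) (hΨ : IsCBMap Ψ)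
    {S : Set G} (h : ∀ g ∈ S, Φ (leftReg g) = Ψ (leftReg g)) {T : EllTwo G →L[ℂ] EllTwo G}
    (hT : T ∈ cLambdaSet S) : Φ T = Ψ T := by
  have := (hΦ.sub hΨ).map_cLambdaSet_mem (V := ⊥) (by simp) (S := S)
    (fun g hg => by simp [h g hg]) hT
  simpa [sub_eq_zero] using this

/-- Two completely bounded maps that exchange `λ(S)` and `λ(S')` give an isomorphism. -/
theorem extendablyIsomorphic_cLambdaSet {S : Set G} {S' : Set G'} (θ : G → G')
    (hθ : θ '' S = S')
    {Φ : (EllTwo G →L[ℂ] EllTwo G) →ₗ[ℂ] (EllTwo G' →L[ℂ] EllTwo G')}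
    {Ψ : (EllTwo G' →L[ℂ] EllTwo G') →ₗ[ℂ] (EllTwo G →L[ℂ] EllTwo G)}
    (hΦ : IsCBMap Φ) (hΨ : IsCBMap Ψ) (h : ∀ g, Φ (leftReg g) = leftReg (θ g))
    (k : ∀ g, Ψ (leftReg (θ g)) = leftReg g) :
    ExtendablyIsomorphic (cLambdaSet S) (cLambdaSet S') := by
  subst hθ
  refine ⟨Φ, Ψ, hΦ, hΨ, fun T hT => ⟨?_, ?_⟩, fun T hT => ⟨?_, ?_⟩⟩
  · exact hΦ.map_cLambdaSet_mem (isClosed_cLambdaSet _)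
      (fun g hg => h g ▸ leftReg_mem_cLambdaSet ⟨g, hg, rfl⟩) hT
  · exact (hΨ.comp hΦ).eqOn_cLambdaSet IsCBMap.id (fun g _ => by simp [h, k]) hT
  · refine hΨ.map_cLambdaSet_mem (isClosed_cLambdaSet _) ?_ hT
    rintro _ ⟨g, hg, rfl⟩
    exact k g ▸ leftReg_mem_cLambdaSet hg
  · refine (hΦ.comp hΨ).eqOn_cLambdaSet IsCBMap.id ?_ hT
    rintro _ ⟨g, hg, rfl⟩
    simp [h, k]

theorem extendablyIsomorphic_smul (g : G) (S : Set G) :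
    ExtendablyIsomorphic (cLambdaSet S) (cLambdaSet (g • S)) := by
  refine extendablyIsomorphic_cLambdaSet (g * ·) rfl
    (isCBMap_sandwich (leftReg g) (.id ℂ _)) (isCBMap_sandwich (leftReg g⁻¹) (.id ℂ _))
    (fun h => ?_) (fun h => ?_)
  · ext ξ x
    simp [leftReg_mul]
  · ext ξ x
    simp [leftReg_apply, mul_assoc]

section Embedding

variable (θ : G →* G')

theorem exists_eq_mul_out (y : G') :
    ∃ g, θ g = y * (Quotient.out (QuotientGroup.mk y⁻¹ : G' ⧸ θ.range)) := by
  have h : y⁻¹⁻¹ * (Quotient.out (QuotientGroup.mk y⁻¹ : G' ⧸ θ.range)) ∈ θ.range :=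
    QuotientGroup.eq.1 (Quotient.out_eq' (QuotientGroup.mk y⁻¹ : G' ⧸ θ.range)).symm
  rwa [inv_inv] at h

/-- The coordinates of an element of `G'` given by its right coset modulo `θ(G)` and its
position in that coset. -/
def cosetCoord (y : G') : (G' ⧸ θ.range) × G :=
  (QuotientGroup.mk y⁻¹, (exists_eq_mul_out θ y).choose)

theorem map_cosetCoord_snd (y : G') :
    θ (cosetCoord θ y).2 = y * (Quotient.out (cosetCoord θ y).1) :=
  (exists_eq_mul_out θ y).choose_spec

theorem cosetCoord_injective : (cosetCoord θ).Injective := by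
  intro y z h
  have h1 := map_cosetCoord_snd θ y
  rw [h, map_cosetCoord_snd θ z] at h1
  exact (mul_right_cancel h1).symm

variable {θ}

/-- Left multiplication by `θ g` preserves the right coset `θ(G) y`, which is recorded as the left
coset of `y⁻¹`. In these coordinates `λ(θ g)` therefore becomes `1 ⊗ λ(g)`. -/
theorem cosetCoord_map_mul (hθ : Function.Injective θ) (g : G) (y : G') :
    cosetCoord θ (θ g * y) = ((cosetCoord θ y).1, g * (cosetCoord θ y).2) := by
  have h1 : (cosetCoord θ (θ g * y)).1 = (cosetCoord θ y).1 := by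
    refine QuotientGroup.eq.2 ?_
    simp
  refine Prod.ext h1 (hθ ?_)
  rw [map_cosetCoord_snd, h1, map_mul, map_cosetCoord_snd, mul_assoc]

/-- The isomorphism class of `C*_λ(S)` does not depend on the ambient group. -/
theorem extendablyIsomorphic_image (hθ : Function.Injective θ) (S : Set G) :
    ExtendablyIsomorphic (cLambdaSet S) (cLambdaSet (θ '' S)) := by
  -- Forward: `1 ⊗ T` read in coset coordinates. Backward: compression to the copy of `ℓ₂(G)`
  -- supported on `θ(G)`.
  refine extendablyIsomorphic_cLambdaSet θ rfl
    ((isCBMap_sandwich (pullback _ (cosetCoord_injective θ))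
      (pushforward _ (cosetCoord_injective θ))).comp isCBMap_ampliation)
    (isCBMap_sandwich (pullback θ hθ) (pushforward θ hθ)) (fun g => ?_) (fun g => ?_)
  · ext ξ y
    have := cosetCoord_map_mul hθ g⁻¹ y
    simp only [LinearMap.comp_apply, sandwich_apply, pullback_apply, ampliation_apply,
      leftReg_apply, slice_apply, ← this, pushforward_apply_self, map_inv]
  · ext ξ x
    simp only [sandwich_apply, pullback_apply, leftReg_apply, ← map_inv, ← map_mul,
      pushforward_apply_self]

end Embedding

/-- `S` is a multiplier set if the projection of `C*_λ(G)` onto `C*_λ(S)` that kills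
`λ(x)`, `x ∉ S`, extends to a completely bounded map on `B(ℓ₂(G))`. -/
def IsMultiplierSet (S : Set G) : Prop :=
  ∃ Φ : (EllTwo G →L[ℂ] EllTwo G) →ₗ[ℂ] (EllTwo G →L[ℂ] EllTwo G), IsCBMap Φ ∧
    (∀ g ∈ S, Φ (leftReg g) = leftReg g) ∧ ∀ g ∉ S, Φ (leftReg g) = 0

/-- On `C*_λ(U)` the multiplier `Φ` and `1 - Φ` are complementary projections onto the two summands.
-/
theorem IsMultiplierSet.extendablyIsomorphic {S S₁ S₂ U : Set G} (hS : IsMultiplierSet S)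
    (h₁ : S₁ ⊆ S) (h₂ : Disjoint S S₂) (hU : S₁ ∪ S₂ = U) :
    ExtendablyIsomorphic (cLambdaSet U) (opDirectSum (cLambdaSet S₁) (cLambdaSet S₂)) := by
  subst hU
  obtain ⟨Φ, hΦ, hin, hout⟩ := hS
  have h₂' : ∀ g ∈ S₂, Φ (leftReg g) = 0 := fun g hg => hout g fun h => h₂.le_bot ⟨h, hg⟩
  have hΦ₁ : ∀ T ∈ cLambdaSet S₁, Φ T = T := fun T hT =>
    hΦ.eqOn_cLambdaSet IsCBMap.id (fun g hg => hin g (h₁ hg)) hT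
  have hΦ₂ : ∀ T ∈ cLambdaSet S₂, Φ T = 0 := fun T hT =>
    hΦ.map_cLambdaSet_mem (V := ⊥) (by simp) (fun g hg => h₂' g hg) hT
  have mono : ∀ {A B : Set G}, A ⊆ B → cLambdaSet A ≤ cLambdaSet B := fun h =>
    Submodule.topologicalClosure_mono (Submodule.span_mono (Set.image_mono h))
  refine extendablyIsomorphic_opDirectSum hΦ (IsCBMap.id.sub hΦ) IsCBMap.id IsCBMap.id
    (fun T hT => ⟨?_, ?_, by simp⟩) (fun T hT => ⟨?_, ?_, ?_⟩) (fun T hT => ⟨?_, ?_, ?_⟩)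
  · refine hΦ.map_cLambdaSet_mem (isClosed_cLambdaSet _) ?_ hT
    rintro g (hg | hg)
    · exact (hin g (h₁ hg)).symm ▸ leftReg_mem_cLambdaSet hg
    · exact (h₂' g hg).symm ▸ zero_mem _
  · refine (IsCBMap.id.sub hΦ).map_cLambdaSet_mem (isClosed_cLambdaSet _) ?_ hT
    rintro g (hg | hg)
    · simp [hin g (h₁ hg)]
    · simpa [h₂' g hg] using leftReg_mem_cLambdaSet hg
  · exact mono Set.subset_union_left hT
  · exact hΦ₁ T hT
  · simp [hΦ₁ T hT]
  · exact mono Set.subset_union_right hT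
  · exact hΦ₂ T hT
  · simp [hΦ₂ T hT]

open Classical in
/-- The block compression `T ↦ ∑ᵢ P_{f⁻¹(i)} T P_{k⁻¹(i)}`. -/
theorem exists_isCBMap_leftReg_apply {I : Type*} (f k : G → I) :
    ∃ Φ : (EllTwo G →L[ℂ] EllTwo G) →ₗ[ℂ] (EllTwo G →L[ℂ] EllTwo G), IsCBMap Φ ∧
      ∀ g ξ x, Φ (leftReg g) ξ x = if f x = k (g⁻¹ * x) then ξ (g⁻¹ * x) else 0 := by
  have inj : ∀ u : G → I, Function.Injective fun x => (u x, x) := fun u x y h =>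
    (Prod.ext_iff.1 h).2
  -- This is `V_f* (1 ⊗ T) V_k` with the isometries `V_u δ_x = δ_(u x, x)`; the matrix entry at `(x,
  -- y)` survives exactly when `f x = k y`.
  refine ⟨sandwich (pullback _ (inj f)) (pushforward _ (inj k)) ∘ₗ ampliation I,
    (isCBMap_sandwich _ _).comp isCBMap_ampliation, fun g ξ x => ?_⟩
  simp only [LinearMap.comp_apply, sandwich_apply, pullback_apply, ampliation_apply,
    leftReg_apply, slice_apply]
  split_ifs with h
  · rw [h]
    exact pushforward_apply_self _ (inj k) ξ _
  · refine pushforward_apply_of_notMem _ (inj k) ξ ?_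
    rintro ⟨y, hy⟩
    obtain ⟨h1, h2⟩ := Prod.ext_iff.1 hy
    exact h (h1.symm.trans (congrArg k h2))

/-- A set whose indicator function, at `x y⁻¹`, is the sum of two block diagonal kernels is a
multiplier set. -/
theorem isMultiplierSet_of_kernels {S : Set G} {I J : Type*} (f k : G → I) (f' k' : G → J)
    (h : ∀ x y, x * y⁻¹ ∈ S ↔ f x = k y ∨ f' x = k' y)
    (hdisj : ∀ x y, ¬(f x = k y ∧ f' x = k' y)) : IsMultiplierSet S := by
  obtain ⟨Φ, hΦ, h1⟩ := exists_isCBMap_leftReg_apply f k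
  obtain ⟨Ψ, hΨ, h2⟩ := exists_isCBMap_leftReg_apply f' k'
  have key : ∀ g x, g ∈ S ↔ f x = k (g⁻¹ * x) ∨ f' x = k' (g⁻¹ * x) := fun g x => by
    rw [← h]
    simp
  refine ⟨Φ + Ψ, hΦ.add hΨ, fun g hg => ?_, fun g hg => ?_⟩
  · ext ξ x
    have h3 := (key g x).1 hg
    have h4 := hdisj x (g⁻¹ * x)
    simp only [LinearMap.add_apply, _root_.add_apply, lp.coeFn_add, Pi.add_apply,
      h1, h2, leftReg_apply]
    rcases h3 with h3 | h3
    · rw [if_pos h3, if_neg fun h5 => h4 ⟨h3, h5⟩, add_zero]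
    · rw [if_pos h3, if_neg fun h5 => h4 ⟨h5, h3⟩, zero_add]
  · ext ξ x
    have h3 := not_or.1 (mt (key g x).2 hg)
    simp [h1, h2, h3.1, h3.2]

end Regular

/-! ### Reduced words and the cosets `e_j F_α` -/

section FreeGroupCosets

variable (d : ℕ ⊕ ℕ ≃ ℕ)

/-- The generator `e_j`. -/
def genE (j : ℕ) : FreeGroup ℕ := FreeGroup.of (d (Sum.inr j))

/-- The union of the cosets `e_j F_α`, `j ∈ J`. -/
def cosetUnion (J : Set ℕ) : Set (FreeGroup ℕ) :=
  ⋃ j ∈ J, genE d j • (subgroupAlpha d : Set (FreeGroup ℕ))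

variable {d}

theorem mem_cosetUnion {J : Set ℕ} {g : FreeGroup ℕ} :
    g ∈ cosetUnion d J ↔ ∃ j ∈ J, (genE d j)⁻¹ * g ∈ subgroupAlpha d := by
  simp [cosetUnion, Set.mem_smul_set_iff_inv_smul_mem]

theorem cosetUnion_univ : cosetUnion d Set.univ = setK d := by
  simp [cosetUnion, setK, genE]

theorem cosetUnion_union (J J' : Set ℕ) :
    cosetUnion d J ∪ cosetUnion d J' = cosetUnion d (J ∪ J') := by
  rw [cosetUnion, cosetUnion, cosetUnion, Set.biUnion_union]

variable (d) in
/-- The homomorphism that kills the generators `α_i` and is injective on the `e_j`. -/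
def killAlpha : FreeGroup ℕ →* FreeGroup ℕ :=
  FreeGroup.lift fun n => Sum.elim (fun _ => 1) FreeGroup.of (d.symm n)

theorem killAlpha_genE (j : ℕ) : killAlpha d (genE d j) = FreeGroup.of j := by
  simp [killAlpha, genE]

theorem killAlpha_eq_one {g : FreeGroup ℕ} (hg : g ∈ subgroupAlpha d) : killAlpha d g = 1 := by
  have : subgroupAlpha d ≤ (killAlpha d).ker := by
    refine (Subgroup.closure_le _).2 ?_
    rintro _ ⟨i, rfl⟩
    simp [killAlpha]
  exact this hg

/-- Killing the `α`'s collapses `e_j F_α` to the `j`-th generator. -/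
theorem index_unique {g : FreeGroup ℕ} {i j : ℕ} (hi : (genE d i)⁻¹ * g ∈ subgroupAlpha d)
    (hj : (genE d j)⁻¹ * g ∈ subgroupAlpha d) : i = j := by
  have h1 := killAlpha_eq_one hi
  have h2 := killAlpha_eq_one hj
  rw [map_mul, map_inv, killAlpha_genE, inv_mul_eq_one] at h1 h2
  exact FreeGroup.of_injective (h1.trans h2.symm)

theorem disjoint_cosetUnion {J J' : Set ℕ} (h : Disjoint J J') :
    Disjoint (cosetUnion d J) (cosetUnion d J') := by
  refine Set.disjoint_left.2 fun g hg hg' => ?_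
  obtain ⟨i, hi, hgi⟩ := mem_cosetUnion.1 hg
  obtain ⟨j, hj, hgj⟩ := mem_cosetUnion.1 hg'
  exact Set.disjoint_left.1 h hi (index_unique hgi hgj ▸ hj)

theorem disjoint_cosetUnion_subgroupAlpha (J : Set ℕ) :
    Disjoint (cosetUnion d J) (subgroupAlpha d) := by
  refine Set.disjoint_left.2 fun g hg hg' => ?_
  obtain ⟨i, -, hgi⟩ := mem_cosetUnion.1 hg
  have h := killAlpha_eq_one hgi
  rw [map_mul, map_inv, killAlpha_genE, killAlpha_eq_one hg', mul_one, inv_eq_one] at h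
  exact FreeGroup.of_ne_one i h

theorem exists_eq_inl_of_mem_toWord {g : FreeGroup ℕ} (hg : g ∈ subgroupAlpha d) :
    ∀ l ∈ g.toWord, ∃ i, l.1 = d (Sum.inl i) := by
  induction hg using Subgroup.closure_induction with
  | mem x hx =>
    obtain ⟨i, rfl⟩ := hx
    intro l hl
    rw [FreeGroup.toWord_of, List.mem_singleton] at hl
    exact ⟨i, by rw [hl]⟩
  | one => simp
  | mul x y _ _ hx hy =>
    intro l hl
    rcases List.mem_append.1 ((FreeGroup.toWord_mul_sublist x y).subset hl) with h | h
    · exact hx l h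
    · exact hy l h
  | inv x _ hx =>
    intro l hl
    rw [FreeGroup.toWord_inv, FreeGroup.invRev, List.mem_reverse, List.mem_map] at hl
    obtain ⟨m, hm, rfl⟩ := hl
    exact hx m hm

/-- The product `e_j b e_i⁻¹ y` has no cancellation: `b` contains only `α`-letters, `e_j` could meet
`e_i⁻¹` only if `b = 1`, and `y` does not begin with `e_i`. -/
theorem head?_toWord_of_eq {b x y : FreeGroup ℕ} {i j : ℕ} (hb : b ∈ subgroupAlpha d)
    (hy : y.toWord.head? ≠ some (d (Sum.inr i), true)) (hne : b = 1 → i ≠ j)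
    (hx : x = genE d j * b * (genE d i)⁻¹ * y) :
    x.toWord.head? = some (d (Sum.inr j), true) := by
  have hword : x = FreeGroup.mk
      ((d (Sum.inr j), true) :: (b.toWord ++ (d (Sum.inr i), false) :: y.toWord)) := by
    rw [hx, ← List.singleton_append, ← List.singleton_append (l := y.toWord)]
    simp only [← FreeGroup.mul_mk, FreeGroup.mk_toWord, mul_assoc]
    rfl
  have hletters := exists_eq_inl_of_mem_toWord hb
  have hred : FreeGroup.IsReduced
      ((d (Sum.inr j), true) :: (b.toWord ++ (d (Sum.inr i), false) :: y.toWord)) := by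
    refine List.isChain_cons.2 ⟨?_, List.isChain_append.2
      ⟨FreeGroup.isReduced_toWord, List.isChain_cons.2 ⟨?_, FreeGroup.isReduced_toWord⟩, ?_⟩⟩
    · intro l hl hjl
      rcases hw : b.toWord with _ | ⟨m, w⟩
      · rw [hw, List.nil_append, List.head?_cons, Option.mem_some_iff] at hl
        subst hl
        exact absurd (Sum.inr_injective (d.injective hjl)).symm
          (hne (FreeGroup.toWord_eq_nil_iff.1 hw))
      · rw [hw, List.cons_append, List.head?_cons, Option.mem_some_iff] at hl
        subst hl
        obtain ⟨k, hk⟩ := hletters m (by simp [hw])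
        exact absurd (d.injective (hjl.trans hk)) (by simp)
    · rintro ⟨n, s⟩ hl rfl
      cases s
      · rfl
      · exact absurd hl hy
    · intro l hl m hm hlm
      obtain ⟨k, hk⟩ := hletters l (List.mem_of_mem_getLast? hl)
      rw [List.head?_cons, Option.mem_some_iff] at hm
      subst hm
      exact absurd (d.injective (hk.symm.trans hlm)) (by simp)
  rw [hword, FreeGroup.toWord_mk, hred.reduce_eq, List.head?_cons]

-- Let `x y⁻¹ ∈ e_j F_α`. If `x` begins with `e_j`, then `j` is determined by `x`, and the condition
-- says that `e_j⁻¹ x` and `y` lie in the same right coset of `F_α`. If not, `y` determines `x`.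
-- Both conditions have the form "a function of `x` equals a function of `y`", and they exclude each
-- other because `j` is unique.
open Classical in
theorem isMultiplierSet_cosetUnion (J : Set ℕ) : IsMultiplierSet (cosetUnion d J) := by
  let start (x : FreeGroup ℕ) (j : ℕ) : Prop := x.toWord.head? = some (d (Sum.inr j), true)
  let A (x y : FreeGroup ℕ) : Prop :=
    ∃ j ∈ J, ¬start x j ∧ (genE d j)⁻¹ * (x * y⁻¹) ∈ subgroupAlpha d
  let B (x y : FreeGroup ℕ) : Prop :=
    ∃ j ∈ J, start x j ∧ (genE d j)⁻¹ * (x * y⁻¹) ∈ subgroupAlpha d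
  -- Eliminating `y` gives `x = e_j b e_i⁻¹ x'` with `b ∈ F_α`. Unless `b = 1` and `i = j`, this
  -- would make `x` begin with `e_j`.
  have hA : ∀ {x x' y}, A x y → A x' y → x = x' := by
    rintro x x' y ⟨j, -, hxj, hj⟩ ⟨i, -, hxi, hi⟩
    by_contra hne
    have hx : x = genE d j * ((genE d j)⁻¹ * (x * y⁻¹) * ((genE d i)⁻¹ * (x' * y⁻¹))⁻¹) *
        (genE d i)⁻¹ * x' := by group
    refine hxj (head?_toWord_of_eq (mul_mem hj (inv_mem hi)) hxi (fun hb hij => hne ?_) hx)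
    rw [hb, hij] at hx
    simpa using hx
  have hstart : ∀ {x i j}, start x i → start x j → i = j := by
    intro x i j hi hj
    have := Option.some_injective _ (hi.symm.trans hj)
    exact Sum.inr_injective (d.injective (Prod.ext_iff.1 this).1)
  -- The default `none`, here and in `f'`, never matches, since the function on the other side only
  -- takes values `some _`.
  let k (y : FreeGroup ℕ) : Option (FreeGroup ℕ) :=
    if h : ∃ x, A x y then some h.choose else none
  let f' (x : FreeGroup ℕ) : Option (FreeGroup ℕ ⧸ subgroupAlpha d) :=
    if h : ∃ j ∈ J, start x j then some (QuotientGroup.mk ((genE d h.choose)⁻¹ * x)⁻¹) else none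
  have hfk : ∀ x y, some x = k y ↔ A x y := by
    intro x y
    by_cases h : ∃ x, A x y
    · simp only [k, dif_pos h, Option.some_inj]
      exact ⟨fun hx => hx ▸ h.choose_spec, fun hx => hA hx h.choose_spec⟩
    · simp only [k, dif_neg h, reduceCtorEq, false_iff]
      exact fun hx => h ⟨x, hx⟩
  have hfk' : ∀ x y, f' x = some (QuotientGroup.mk y⁻¹) ↔ B x y := by
    intro x y
    by_cases h : ∃ j ∈ J, start x j
    · simp only [f', dif_pos h, Option.some_inj, QuotientGroup.eq, inv_inv, mul_assoc]
      refine ⟨fun hx => ⟨_, h.choose_spec.1, h.choose_spec.2, hx⟩, ?_⟩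
      rintro ⟨j, -, hj, hx⟩
      exact hstart hj h.choose_spec.2 ▸ hx
    · simp only [f', dif_neg h, reduceCtorEq, false_iff]
      rintro ⟨j, hj, hs, -⟩
      exact h ⟨j, hj, hs⟩
  refine isMultiplierSet_of_kernels some k f' (fun y => some (QuotientGroup.mk y⁻¹))
    (fun x y => ?_) (fun x y => ?_)
  · rw [hfk, hfk', mem_cosetUnion]
    constructor
    · rintro ⟨j, hj, h⟩
      by_cases hs : start x j
      · exact Or.inr ⟨j, hj, hs, h⟩
      · exact Or.inl ⟨j, hj, hs, h⟩
    · rintro (⟨j, hj, -, h⟩ | ⟨j, hj, -, h⟩) <;> exact ⟨j, hj, h⟩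
  · rw [hfk, hfk']
    rintro ⟨⟨j, -, hj, hxj⟩, ⟨i, -, hi, hxi⟩⟩
    exact hj (index_unique hxi hxj ▸ hi)

/-! ### Coset unions under endomorphisms that fix the `α`'s -/

theorem image_subgroupAlpha {θ : FreeGroup ℕ →* FreeGroup ℕ}
    (hθ : ∀ i, θ (FreeGroup.of (d (Sum.inl i))) = FreeGroup.of (d (Sum.inl i))) :
    θ '' (subgroupAlpha d) = (subgroupAlpha d : Set (FreeGroup ℕ)) := by
  rw [← Subgroup.coe_map, subgroupAlpha, MonoidHom.map_closure, ← Set.range_comp]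
  simp only [Function.comp_def, hθ]

theorem image_cosetUnion {θ : FreeGroup ℕ →* FreeGroup ℕ}
    (hθ : ∀ i, θ (FreeGroup.of (d (Sum.inl i))) = FreeGroup.of (d (Sum.inl i))) (J : Set ℕ) :
    θ '' cosetUnion d J = ⋃ j ∈ J, θ (genE d j) • (subgroupAlpha d : Set (FreeGroup ℕ)) := by
  simp only [cosetUnion, Set.image_iUnion, Set.image_smul_distrib, image_subgroupAlpha hθ]

/-- Renaming `e_j` to `e_(σ j)` is an injective endomorphism. -/
theorem extendablyIsomorphic_cosetUnion_range {σ : ℕ → ℕ} (hσ : σ.Injective) :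
    ExtendablyIsomorphic (cLambdaSet (setK d)) (cLambdaSet (cosetUnion d (Set.range σ))) := by
  have hι : Function.Injective (d ∘ Sum.map id σ ∘ d.symm) :=
    d.injective.comp ((Function.injective_id.sumMap hσ).comp d.symm.injective)
  have h := extendablyIsomorphic_image (FreeGroup.map_injective hι) (setK d)
  rwa [← cosetUnion_univ, image_cosetUnion (by simp), Set.biUnion_univ,
    show (⋃ j, FreeGroup.map (d ∘ Sum.map id σ ∘ d.symm) (genE d j) •
      (subgroupAlpha d : Set (FreeGroup ℕ))) = cosetUnion d (Set.range σ) by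
        simp [cosetUnion, genE], cosetUnion_univ] at h

theorem extendablyIsomorphic_subgroupAlpha :
    ExtendablyIsomorphic (cLambdaSet (subgroupAlpha d : Set (FreeGroup ℕ)))
      (cLambda (FreeGroup ℕ)) := by
  have hι : Function.Injective (d ∘ Sum.inl) := d.injective.comp Sum.inl_injective
  have h := extendablyIsomorphic_image (FreeGroup.map_injective hι) Set.univ
  rw [Set.image_univ, ← MonoidHom.coe_range, FreeGroup.range_map, ← Set.range_comp] at h
  exact h.symm

variable (d) in
/-- The endomorphism that multiplies `e_1, e_2, …` by `s` on the left and fixes `e_0` and the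
`α_i`. -/
def twist (s : FreeGroup ℕ) : FreeGroup ℕ →* FreeGroup ℕ :=
  FreeGroup.lift fun n => Sum.elim (fun _ => FreeGroup.of n)
    (fun j => if j = 0 then FreeGroup.of n else s * FreeGroup.of n) (d.symm n)

theorem twist_inl (s : FreeGroup ℕ) (i : ℕ) :
    twist d s (FreeGroup.of (d (Sum.inl i))) = FreeGroup.of (d (Sum.inl i)) := by
  simp [twist]

theorem twist_genE_zero (s : FreeGroup ℕ) : twist d s (genE d 0) = genE d 0 := by
  simp [twist, genE]

theorem twist_genE_succ (s : FreeGroup ℕ) (j : ℕ) :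
    twist d s (genE d (j + 1)) = s * genE d (j + 1) := by
  simp [twist, genE]

/-- Since `e_0` is fixed, the twist by `e_0` undoes the twist by `e_0⁻¹`. -/
theorem twist_injective : Function.Injective (twist d (genE d 0)⁻¹) := by
  have h : (twist d (genE d 0)).comp (twist d (genE d 0)⁻¹) = MonoidHom.id _ := by
    refine FreeGroup.ext_hom _ _ fun n => ?_
    obtain ⟨i | j, rfl⟩ := d.surjective n
    · simp [twist_inl]
    · change twist d _ (twist d _ (genE d j)) = genE d j
      cases j with
      | zero => simp [twist_genE_zero]
      | succ j => simp [twist_genE_zero, twist_genE_succ]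
  exact Function.LeftInverse.injective (DFunLike.congr_fun h)

/-- Translating by `e_0⁻¹` turns `e_0 F_α` into `F_α` and the other cosets into `e_0⁻¹ e_j F_α`,
which are the images of `e_j F_α` under the twist. -/
theorem extendablyIsomorphic_subgroupAlpha_union :
    ExtendablyIsomorphic
      (cLambdaSet ((subgroupAlpha d : Set (FreeGroup ℕ)) ∪ cosetUnion d (Set.range Nat.succ)))
      (cLambdaSet (setK d)) := by
  have h := extendablyIsomorphic_image (twist_injective (d := d))
    ((subgroupAlpha d : Set (FreeGroup ℕ)) ∪ cosetUnion d (Set.range Nat.succ))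
  have hset : twist d (genE d 0)⁻¹ '' ((subgroupAlpha d : Set (FreeGroup ℕ)) ∪
      cosetUnion d (Set.range Nat.succ)) = (genE d 0)⁻¹ • setK d := by
    rw [Set.image_union, image_subgroupAlpha (twist_inl _), image_cosetUnion (twist_inl _),
      Set.biUnion_range, ← cosetUnion_univ, cosetUnion, Set.biUnion_univ, Set.smul_set_iUnion,
      ← Set.union_iUnion_nat_succ fun j =>
        (genE d 0)⁻¹ • genE d j • (subgroupAlpha d : Set (FreeGroup ℕ))]
    simp only [Nat.succ_eq_add_one, twist_genE_succ, mul_smul, inv_smul_smul]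
  rw [hset] at h
  exact h.trans (extendablyIsomorphic_smul _ _).symm

end FreeGroupCosets

end

/-! ### The decomposition argument -/

theorem proposition5 (d : ℕ ⊕ ℕ ≃ ℕ) (K : Set (FreeGroup ℕ))
    (hK : K = setK d ∨ K = (subgroupAlpha d : Set (FreeGroup ℕ)) ∪ setK d) :
    CompletelyIsomorphic (cLambdaSet K) (cLambda (FreeGroup ℕ)) ∧
    CompletelyIsomorphic (cLambda (FreeGroup ℕ))
      (opDirectSum (cLambda (FreeGroup ℕ)) (cLambda (FreeGroup ℕ))) ∧
    CompletelyIsomorphic (cLambdaSet K)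
      (opDirectSum (cLambda (FreeGroup ℕ)) (cLambda (FreeGroup ℕ))) := by
  let E : Set ℕ := Set.range (2 * ·)
  let O : Set ℕ := Set.range (2 * · + 1)
  have hEO : E ∪ O = Set.univ := Set.eq_univ_of_forall fun n => by
    rcases Nat.even_or_odd' n with ⟨m, h | h⟩
    · exact Or.inl ⟨m, h.symm⟩
    · exact Or.inr ⟨m, h.symm⟩
  have hdisj : Disjoint E O := Set.disjoint_left.2 fun n => by
    rintro ⟨a, rfl⟩ ⟨b, h⟩
    dsimp only at h
    omega
  have hKE : ExtendablyIsomorphic (cLambdaSet (setK d)) (cLambdaSet (cosetUnion d E)) :=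
    extendablyIsomorphic_cosetUnion_range fun a b h => by simpa using h
  have hKO : ExtendablyIsomorphic (cLambdaSet (setK d)) (cLambdaSet (cosetUnion d O)) :=
    extendablyIsomorphic_cosetUnion_range fun a b h => by simpa using h
  have hunion : cosetUnion d E ∪ cosetUnion d O = setK d := by
    rw [cosetUnion_union, hEO, cosetUnion_univ]
  -- `C*_λ(K) ≃ C*_λ(K) ⊕ C*_λ(K)`
  have hKK : ExtendablyIsomorphic (cLambdaSet (setK d))
      (opDirectSum (cLambdaSet (setK d)) (cLambdaSet (setK d))) :=
    ((isMultiplierSet_cosetUnion E).extendablyIsomorphic subset_rfl (disjoint_cosetUnion hdisj)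
      hunion).trans (hKE.symm.opDirectSum hKO.symm)
  -- `C*_λ(F_α ∪ ⋃_{j ∈ J} e_j F_α) ≃ C*_λ(F_∞) ⊕ C*_λ(K)` for infinite `J`
  have halpha : ∀ J : Set ℕ,
      ExtendablyIsomorphic (cLambdaSet (setK d)) (cLambdaSet (cosetUnion d J)) →
      ExtendablyIsomorphic
        (cLambdaSet ((subgroupAlpha d : Set (FreeGroup ℕ)) ∪ cosetUnion d J))
        (opDirectSum (cLambdaSet (setK d)) (cLambda (FreeGroup ℕ))) := fun J hJ =>
    ((isMultiplierSet_cosetUnion J).extendablyIsomorphic subset_rfl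
      (disjoint_cosetUnion_subgroupAlpha J) (Set.union_comm _ _)).trans
      (hJ.symm.opDirectSum extendablyIsomorphic_subgroupAlpha)
  -- Up to isomorphism, the coset of `e_0` serves as `F_α`, and the remaining cosets are again a
  -- copy of `K`.
  have hKF : ExtendablyIsomorphic (cLambdaSet (setK d))
      (opDirectSum (cLambdaSet (setK d)) (cLambda (FreeGroup ℕ))) :=
    extendablyIsomorphic_subgroupAlpha_union.symm.trans
      (halpha _ (extendablyIsomorphic_cosetUnion_range Nat.succ_injective))
  -- `C*_λ(F_∞) ≃ C*_λ(K) ⊕ C*_λ(F_∞)`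
  have hK_compl : ExtendablyIsomorphic (cLambda (FreeGroup ℕ))
      (opDirectSum (cLambdaSet (setK d)) (cLambdaSet (setK d)ᶜ)) :=
    (cosetUnion_univ (d := d) ▸ isMultiplierSet_cosetUnion Set.univ :
      IsMultiplierSet (setK d)).extendablyIsomorphic subset_rfl disjoint_compl_right
      (Set.union_compl_self _)
  -- The complement of the even half is the odd half, a copy of `K`, together with `Kᶜ`; its space
  -- is thus isomorphic to `C*_λ(F_∞)` itself.
  have hO_compl : ExtendablyIsomorphic (cLambdaSet (cosetUnion d E)ᶜ)
      (opDirectSum (cLambdaSet (cosetUnion d O)) (cLambdaSet (setK d)ᶜ)) := by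
    refine (isMultiplierSet_cosetUnion O).extendablyIsomorphic subset_rfl ?_ ?_
    · exact disjoint_compl_right.mono_left (hunion ▸ Set.subset_union_right)
    · have h := Set.disjoint_left.1 (disjoint_cosetUnion (d := d) hdisj)
      ext g
      simp only [← hunion, Set.mem_union, Set.mem_compl_iff]
      have := @h g
      tauto
  have hFK : ExtendablyIsomorphic (cLambda (FreeGroup ℕ))
      (opDirectSum (cLambdaSet (setK d)) (cLambda (FreeGroup ℕ))) :=
    ((isMultiplierSet_cosetUnion E).extendablyIsomorphic subset_rfl disjoint_compl_right
      (Set.union_compl_self _)).trans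
      (hKE.symm.opDirectSum
        (hO_compl.trans ((hKO.symm.opDirectSum (.refl _)).trans hK_compl.symm)))
  have hiso : ExtendablyIsomorphic (cLambdaSet (setK d)) (cLambda (FreeGroup ℕ)) :=
    hKF.trans hFK.symm
  have hsum : ExtendablyIsomorphic (cLambda (FreeGroup ℕ))
      (opDirectSum (cLambda (FreeGroup ℕ)) (cLambda (FreeGroup ℕ))) :=
    hiso.symm.trans (hKK.trans (hiso.opDirectSum hiso))
  have hKiso : ExtendablyIsomorphic (cLambdaSet K) (cLambda (FreeGroup ℕ)) := by
    rcases hK with rfl | rfl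
    · exact hiso
    · have h := halpha Set.univ (by rw [cosetUnion_univ]; exact .refl _)
      rw [cosetUnion_univ] at h
      exact h.trans hFK.symm
  exact ⟨hKiso.completelyIsomorphic, hsum.completelyIsomorphic,
    (hKiso.trans hsum).completelyIsomorphic⟩
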